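/- Let $G$ be a (discrete) group. Regard $\ell^1(G)$ as a complex Banach algebra under the convolution product $(a\star b)(s)=\sum_{t\in G}a(t)\,b(t^{-1}s)$ and, for $1\le r<\infty$, regard $\ell^r(G)$ as a Banach left $\ell^1(G)$-module under $(a\star x)(s)=\sum_{t\in G}a(t)\,x(t^{-1}s)$ $(a\in\ell^1(G),\ x\in\ell^r(G),\ s\in G)$. A Banach left module $J$ over a Banach algebra $A$ is called injective if, for all Banach left $A$-modules $E,F$, every injective bounded $A$-module morphism $T:E\to F$ that has a bounded linear left inverse, and every bounded $A$-module morphism $S:E\to J$, there is a bounded $A$-module morphism $R:F\to J$ with $R\circ T=S$. Let $1<p<\infty$. If $\ell^p(G)$ is an injective Banach left $\ell^1(G)$-module, then $\ell^q(G)$ is an injective Banach left $\ell^1(G)$-module for every $q$ with $p\le q<\infty$. -/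

import Mathlib

open scoped ENNReal

universe u v w

noncomputable section

/-! ### Banach left modules over a Banach algebra and injectivity -/

/-- The structure of a Banach left `A`-module on a Banach space `E`, for a complex Banach algebra
`A`: a bounded bilinear map
`(a, x) ↦ a · x` from `A × E` to `E` with `(a b) · x = a · (b · x)`. Neither `A` nor the action is
required to be unital. -/
structure BanachLeftModule (A : Type u) [NonUnitalNormedRing A] [NormedSpace ℂ A]
    [IsScalarTower ℂ A A] [SMulCommClass ℂ A A] [CompleteSpace A]
    (E : Type v) [NormedAddCommGroup E] [NormedSpace ℂ E] [CompleteSpace E] where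
  /-- the module operation -/
  act : A →L[ℂ] E →L[ℂ] E
  mul_act : ∀ (a b : A) (x : E), act (a * b) x = act a (act b x)

namespace BanachLeftModule

/-- A bounded operator `T : E → F` is a morphism of left `A`-modules if `T (a · x) = a · T x`. -/
def IsMorphism {A : Type u} [NonUnitalNormedRing A] [NormedSpace ℂ A]
    [IsScalarTower ℂ A A] [SMulCommClass ℂ A A] [CompleteSpace A]
    {E : Type v} [NormedAddCommGroup E] [NormedSpace ℂ E] [CompleteSpace E]
    {F : Type w} [NormedAddCommGroup F] [NormedSpace ℂ F] [CompleteSpace F]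
    (mE : BanachLeftModule A E) (mF : BanachLeftModule A F) (T : E →L[ℂ] F) : Prop :=
  ∀ (a : A) (x : E), T (mE.act a x) = mF.act a (T x)

/-- An injective bounded operator `T : E → F` is admissible if it has a bounded linear left
inverse. -/
def IsAdmissibleMono {E : Type v} [NormedAddCommGroup E] [NormedSpace ℂ E]
    {F : Type w} [NormedAddCommGroup F] [NormedSpace ℂ F] (T : E →L[ℂ] F) : Prop :=
  Function.Injective T ∧ ∃ S : F →L[ℂ] E, S.comp T = ContinuousLinearMap.id ℂ E

/-- Injectivity of the Banach left `A`-module `J`: for all Banach left `A`-modules `E` and `F`,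
every morphism `E → J` extends along every admissible monomorphism of modules `E → F` to a
morphism `F → J`. -/
def IsInjective {A J : Type u} [NonUnitalNormedRing A] [NormedSpace ℂ A]
    [IsScalarTower ℂ A A] [SMulCommClass ℂ A A] [CompleteSpace A]
    [NormedAddCommGroup J] [NormedSpace ℂ J] [CompleteSpace J] (mJ : BanachLeftModule A J) : Prop :=
  ∀ (E F : Type u) [NormedAddCommGroup E] [NormedSpace ℂ E] [CompleteSpace E]
    [NormedAddCommGroup F] [NormedSpace ℂ F] [CompleteSpace F]
    (mE : BanachLeftModule A E) (mF : BanachLeftModule A F) (T : E →L[ℂ] F) (S : E →L[ℂ] J),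
    IsMorphism mE mF T → IsAdmissibleMono T → IsMorphism mE mJ S →
      ∃ R : F →L[ℂ] J, IsMorphism mF mJ R ∧ R.comp T = S

end BanachLeftModule

/-! ### The spaces `ℓ^p(G)` and the convolution action of `ℓ¹(G)` -/

/-- The complex Banach space `ℓ^p(G)`. -/
abbrev Ell (G : Type u) (p : ℝ≥0∞) : Type u := lp (fun _ : G => ℂ) p

namespace Ell

section

variable {G : Type u} {p : ℝ≥0∞} [Fact (1 ≤ p)]

theorem summable_norm_one (a : Ell G 1) : Summable fun t => ‖a t‖ := by
  simpa using (lp.memℓp a).summable (by simp)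

theorem norm_one_eq (a : Ell G 1) : ‖a‖ = ∑' t, ‖a t‖ := by
  simpa using lp.norm_eq_tsum_rpow (p := 1) (by simp) a

theorem memℓp_comp_equiv (e : G ≃ G) (x : Ell G p) : Memℓp (fun s => x (e s)) p := by
  have hx := lp.memℓp x
  rcases p.trichotomy with rfl | rfl | hp
  · exact absurd (Fact.out : (1 : ℝ≥0∞) ≤ 0) (by simp)
  · rw [memℓp_infty_iff] at hx ⊢
    exact hx.mono (Set.range_comp_subset_range e fun s => ‖x s‖)
  · rw [memℓp_gen_iff hp] at hx ⊢
    exact e.summable_iff.2 hx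

end

variable {G : Type u} [Group G] {p : ℝ≥0∞} [Fact (1 ≤ p)]

/-- Left translation on `ℓ^p(G)`, `(t · x)(s) = x (t⁻¹ s)`. -/
def translate (t : G) (x : Ell G p) : Ell G p :=
  ⟨fun s => x (t⁻¹ * s), memℓp_comp_equiv (Equiv.mulLeft t⁻¹) x⟩

theorem translate_apply (t : G) (x : Ell G p) (s : G) : translate t x s = x (t⁻¹ * s) := rfl

theorem norm_translate (t : G) (x : Ell G p) : ‖translate t x‖ = ‖x‖ := by
  rcases p.trichotomy with rfl | rfl | hp
  · exact absurd (Fact.out : (1 : ℝ≥0∞) ≤ 0) (by simp)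
  · rw [lp.norm_eq_ciSup, lp.norm_eq_ciSup]
    exact (Equiv.mulLeft t⁻¹).iSup_comp (g := fun s => ‖x s‖)
  · rw [lp.norm_eq_tsum_rpow hp, lp.norm_eq_tsum_rpow hp]
    congr 1
    exact (Equiv.mulLeft t⁻¹).tsum_eq fun s => ‖x s‖ ^ p.toReal

theorem translate_add (t : G) (x y : Ell G p) :
    translate t (x + y) = translate t x + translate t y := rfl

theorem translate_smul (t : G) (c : ℂ) (x : Ell G p) :
    translate t (c • x) = c • translate t x := rfl

theorem summable_smul_translate (a : Ell G 1) (x : Ell G p) :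
    Summable fun t => a t • translate t x := by
  apply Summable.of_norm
  simpa [norm_smul, norm_translate] using (summable_norm_one a).mul_right ‖x‖

theorem tsum_smul_translate_apply (a : Ell G 1) (x : Ell G p) (s : G) :
    (∑' t, a t • translate t x : Ell G p) s = ∑' t, a t * x (t⁻¹ * s) :=
  (lp.evalCLM ℂ (fun _ : G => ℂ) p s).map_tsum (summable_smul_translate a x)

theorem memℓp_conv (a : Ell G 1) (x : Ell G p) :
    Memℓp (fun s => ∑' t, a t * x (t⁻¹ * s)) p := by
  have h := lp.memℓp (∑' t, a t • translate t x : Ell G p)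
  rwa [show ((∑' t, a t • translate t x : Ell G p) : G → ℂ) = fun s => ∑' t, a t * x (t⁻¹ * s)
    from funext (tsum_smul_translate_apply a x)] at h

/-- The convolution `a ⋆ x` of `a ∈ ℓ¹(G)` and `x ∈ ℓ^p(G)`,
`(a ⋆ x)(s) = ∑_{t ∈ G} a(t) x(t⁻¹ s)`. -/
def conv (a : Ell G 1) (x : Ell G p) : Ell G p :=
  ⟨fun s => ∑' t, a t * x (t⁻¹ * s), memℓp_conv a x⟩

theorem conv_apply (a : Ell G 1) (x : Ell G p) (s : G) :
    conv a x s = ∑' t, a t * x (t⁻¹ * s) := rfl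

theorem conv_eq_tsum (a : Ell G 1) (x : Ell G p) : conv a x = ∑' t, a t • translate t x :=
  lp.ext (funext fun s => (tsum_smul_translate_apply a x s).symm)

theorem norm_conv_le (a : Ell G 1) (x : Ell G p) : ‖conv a x‖ ≤ ‖a‖ * ‖x‖ := by
  have h : ∀ t, ‖a t • translate t x‖ = ‖a t‖ * ‖x‖ := fun t => by
    rw [norm_smul, norm_translate]
  rw [conv_eq_tsum, norm_one_eq, ← tsum_mul_right]
  refine (norm_tsum_le_tsum_norm ?_).trans_eq (tsum_congr h)
  simpa only [h] using (summable_norm_one a).mul_right ‖x‖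

theorem add_conv (a b : Ell G 1) (x : Ell G p) : conv (a + b) x = conv a x + conv b x := by
  simp only [conv_eq_tsum, lp.coeFn_add, Pi.add_apply, add_smul]
  exact (summable_smul_translate a x).tsum_add (summable_smul_translate b x)

theorem conv_add (a : Ell G 1) (x y : Ell G p) : conv a (x + y) = conv a x + conv a y := by
  simp only [conv_eq_tsum, translate_add, smul_add]
  exact (summable_smul_translate a x).tsum_add (summable_smul_translate a y)

theorem smul_conv (c : ℂ) (a : Ell G 1) (x : Ell G p) : conv (c • a) x = c • conv a x := by
  simp only [conv_eq_tsum, lp.coeFn_smul, Pi.smul_apply, smul_assoc]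
  exact (summable_smul_translate a x).tsum_const_smul c

theorem conv_smul (c : ℂ) (a : Ell G 1) (x : Ell G p) : conv a (c • x) = c • conv a x := by
  simp only [conv_eq_tsum, translate_smul, smul_comm _ c]
  exact (summable_smul_translate a x).tsum_const_smul c

/-- Convolution as a bounded bilinear map `ℓ¹(G) × ℓ^p(G) → ℓ^p(G)`. -/
def convCLM (G : Type u) [Group G] (p : ℝ≥0∞) [Fact (1 ≤ p)] :
    Ell G 1 →L[ℂ] Ell G p →L[ℂ] Ell G p :=
  LinearMap.mkContinuous₂ (LinearMap.mk₂ ℂ conv add_conv smul_conv conv_add conv_smul) 1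
    fun a x => by simpa using norm_conv_le a x

theorem convCLM_apply (a : Ell G 1) (x : Ell G p) : convCLM G p a x = conv a x := rfl

theorem conv_conv (a b : Ell G 1) (x : Ell G p) : conv (conv a b) x = conv a (conv b x) := by
  classical
  have hT : ∀ (t : G) (b : Ell G 1), translate t (conv b x) = conv (translate t b) x := by
    intro t b
    refine lp.ext (funext fun s => ?_)
    rw [translate_apply, conv_apply, conv_apply, ← (Equiv.mulLeft t⁻¹).tsum_eq]
    refine tsum_congr fun r => ?_
    simp [translate_apply, mul_assoc]
  have h : conv (conv a b) x = ∑' t, conv (a t • translate t b) x := by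
    rw [conv_eq_tsum a b]
    exact ((convCLM G p).flip x).map_tsum (summable_smul_translate a b)
  rw [h, conv_eq_tsum a]
  exact tsum_congr fun t => by rw [smul_conv, hT]

/-- The Banach algebra `ℓ¹(G)`, with convolution as its product. -/
instance instNonUnitalNormedRing : NonUnitalNormedRing (Ell G 1) :=
  { (inferInstance : NormedAddCommGroup (Ell G 1)) with
    mul := fun a b => conv (p := 1) a b
    left_distrib := fun a b c => conv_add (p := 1) a b c
    right_distrib := fun a b c => add_conv (p := 1) a b c
    zero_mul := fun x => by
      change conv (p := 1) (0 : Ell G 1) x = 0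
      simpa using smul_conv (p := 1) (0 : ℂ) 0 x
    mul_zero := fun a => by
      change conv (p := 1) a (0 : Ell G 1) = 0
      simpa using conv_smul (p := 1) (0 : ℂ) a 0
    mul_assoc := fun a b c => conv_conv (p := 1) a b c
    norm_mul_le := fun a b => norm_conv_le (p := 1) a b }

instance instIsScalarTower : IsScalarTower ℂ (Ell G 1) (Ell G 1) :=
  ⟨fun c a b => smul_conv (p := 1) c a b⟩

instance instSMulCommClass : SMulCommClass ℂ (Ell G 1) (Ell G 1) :=
  ⟨fun c a b => (conv_smul (p := 1) c a b).symm⟩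

theorem mul_apply (a b : Ell G 1) (s : G) : (a * b) s = ∑' t, a t * b (t⁻¹ * s) := rfl

/-- `ℓ^p(G)` as a Banach left `ℓ¹(G)`-module, with convolution as the module operation. -/
def banachModule (G : Type u) [Group G] (p : ℝ≥0∞) [Fact (1 ≤ p)] :
    BanachLeftModule (Ell G 1) (Ell G p) where
  act := convCLM G p
  mul_act := conv_conv

end Ell

end

noncomputable section

/-! Injectivity of $\ell^p(G)$ amounts to a weak form of amenability: a bounded functional $m$ on
$\ell^\infty(G)$ with $m(1)=1$ and $\sum_u|m(g_u)|^p\le C\sup_t\sum_u|g_u(tu)|^p$ for finite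
families $(g_u)$. A retraction of $B(\ell^1,\ell^p)$ onto $\ell^p$ yields $m$
(`exists_hasUpperEstimate`); conversely, averaging with $m$ turns a linear extension into a module
morphism (`isInjective_of_hasUpperEstimate`).

The exponent now enters only through the estimate, which passes from $p$ to $q\ge p$ with the same
$m$: cutting $f$ off below a level comparable with $|m(f)|$ keeps half of $m(f)$, and above that
level $|f|^p$ times a power of the level is at most $|f|^q$ (`exists_truncation`). -/

open scoped Classical in
/-- The point mass at `s`, as an element of `ℓ^p(G)`. -/
def Ell.delta {G : Type u} (p : ℝ≥0∞) (s : G) : Ell G p := lp.single p s 1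

namespace Ell

/-! ### Operators on $\ell^1(G)$ determined by point masses -/

section Basis

variable {G : Type u}

theorem delta_apply_self (p : ℝ≥0∞) (s : G) : delta p s s = 1 := by
  classical
  simp [delta]

theorem norm_delta (p : ℝ≥0∞) [hp : Fact (1 ≤ p)] (s : G) : ‖delta p s‖ = 1 := by
  classical
  rw [delta, lp.norm_single (zero_lt_one.trans_le hp.out), norm_one]

theorem hasSum_smul_delta (a : Ell G 1) : HasSum (fun t => a t • delta 1 t) a := by
  classical
  convert! lp.hasSum_single (by simp) a using 2 with t
  rw [delta, ← lp.single_smul, smul_eq_mul, mul_one]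

variable {E : Type v} [NormedAddCommGroup E] [NormedSpace ℂ E]

theorem clm_ext {T S : Ell G 1 →L[ℂ] E} (h : ∀ t, T (delta 1 t) = S (delta 1 t)) : T = S := by
  ext1 a
  have hT := (hasSum_smul_delta a).mapL T
  have hS := (hasSum_smul_delta a).mapL S
  simp only [map_smul, h] at hT hS
  exact hT.unique hS

theorem norm_clm_le {T : Ell G 1 →L[ℂ] E} {K : ℝ} (hK : 0 ≤ K)
    (h : ∀ t, ‖T (delta 1 t)‖ ≤ K) : ‖T‖ ≤ K := by
  refine T.opNorm_le_bound hK fun a => ?_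
  have hT := (hasSum_smul_delta a).mapL T
  simp only [map_smul] at hT
  have ha := (summable_norm_one a).hasSum
  rw [← norm_one_eq] at ha
  refine hT.norm_le_of_bounded (ha.mul_left K) fun t => ?_
  rw [norm_smul, mul_comm]
  gcongr
  exact h t

variable [CompleteSpace E]

theorem exists_clm_delta (Φ : G → E) {K : ℝ} (h : ∀ t, ‖Φ t‖ ≤ K) :
    ∃ T : Ell G 1 →L[ℂ] E, ∀ t, T (delta 1 t) = Φ t := by
  classical
  have hle : ∀ (a : Ell G 1) t, ‖a t • Φ t‖ ≤ ‖a t‖ * K := fun a t => by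
    rw [norm_smul]
    gcongr
    exact h t
  have hs : ∀ a : Ell G 1, Summable fun t => a t • Φ t := fun a =>
    .of_norm_bounded ((summable_norm_one a).mul_right K) (hle a)
  let L : Ell G 1 →ₗ[ℂ] E :=
    { toFun := fun a => ∑' t, a t • Φ t
      map_add' := fun a b => by
        simp only [lp.coeFn_add, Pi.add_apply, add_smul]
        exact (hs a).tsum_add (hs b)
      map_smul' := fun c a => by
        simp only [lp.coeFn_smul, Pi.smul_apply, smul_assoc, RingHom.id_apply]
        exact (hs a).tsum_const_smul c }
  refine ⟨L.mkContinuous K fun a => ?_, fun t => ?_⟩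
  · have ha := (summable_norm_one a).hasSum
    rw [← norm_one_eq] at ha
    rw [mul_comm]
    exact (hs a).hasSum.norm_le_of_bounded (ha.mul_right K) (hle a)
  · change ∑' r, delta 1 t r • Φ r = Φ t
    rw [tsum_eq_single t, delta_apply_self, one_smul]
    intro r hr
    simp [delta, hr]

/-- Bounded functions act on `ℓ¹(G)` by pointwise multiplication. -/
theorem exists_mulCLM (G : Type u) :
    ∃ M : Ell G ∞ →L[ℂ] Ell G 1 →L[ℂ] Ell G 1, ∀ g t, M g (delta 1 t) = g t • delta 1 t := by
  have h : ∀ (g : Ell G ∞) t, ‖g t • delta 1 t‖ ≤ ‖g‖ := fun g t => by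
    rw [norm_smul, norm_delta, mul_one]
    exact lp.norm_apply_le_norm (by simp) g t
  choose M hM using fun g : Ell G ∞ => exists_clm_delta (fun t => g t • delta 1 t) (h g)
  let L : Ell G ∞ →ₗ[ℂ] Ell G 1 →L[ℂ] Ell G 1 :=
    { toFun := M
      map_add' := fun f g => clm_ext fun t => by simp [hM, add_smul]
      map_smul' := fun c g => clm_ext fun t => by simp [hM, mul_smul] }
  refine ⟨L.mkContinuous 1 fun g => ?_, hM⟩
  rw [one_mul]
  refine norm_clm_le (norm_nonneg g) fun t => ?_
  change ‖M g _‖ ≤ _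
  rw [hM]
  exact h g t

end Basis

section Group

variable {G : Type u} [Group G] {p : ℝ≥0∞} [Fact (1 ≤ p)]

theorem delta_conv (s : G) (x : Ell G p) : conv (delta 1 s) x = translate s x := by
  classical
  rw [conv_eq_tsum, tsum_eq_single s, delta_apply_self, one_smul]
  intro t ht
  simp [delta, ht]

theorem translate_delta (s t : G) : translate s (delta p t) = delta p (s * t) := by
  classical
  refine lp.ext (funext fun r => ?_)
  simp only [translate_apply, delta, lp.single_apply, Pi.single_apply, inv_mul_eq_iff_eq_mul]

theorem delta_mul_delta (s t : G) : delta 1 s * delta 1 t = delta 1 (s * t) :=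
  (delta_conv s (delta 1 t)).trans (translate_delta s t)

end Group

end Ell

/-! ### Retractions from coinduced modules -/

namespace BanachLeftModule

variable {A J : Type u} [NonUnitalNormedRing A] [NormedSpace ℂ A]
    [IsScalarTower ℂ A A] [SMulCommClass ℂ A A] [CompleteSpace A]
    [NormedAddCommGroup J] [NormedSpace ℂ J] [CompleteSpace J]

/-- The bounded operators from `A` to `J`, as a left module: `(a · T) b = T (b a)`. -/
def coinduced (A J : Type u) [NonUnitalNormedRing A] [NormedSpace ℂ A]
    [IsScalarTower ℂ A A] [SMulCommClass ℂ A A] [CompleteSpace A]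
    [NormedAddCommGroup J] [NormedSpace ℂ J] [CompleteSpace J] :
    BanachLeftModule A (A →L[ℂ] J) where
  act := (ContinuousLinearMap.compL ℂ A A J).flip ∘L (ContinuousLinearMap.mul ℂ A).flip
  mul_act a b T := by
    ext c
    simp [mul_assoc]

theorem coinduced_act_apply (a b : A) (T : A →L[ℂ] J) :
    (coinduced A J).act a T b = T (b * a) := by
  simp [coinduced]

/-- The embedding $x\mapsto(a\mapsto a\cdot x)$ is an admissible monomorphism, since evaluation at
`e` inverts it; extend the identity of `J` along it. -/
theorem IsInjective.exists_retraction {mJ : BanachLeftModule A J} (h : mJ.IsInjective) {e : A}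
    (he : ∀ x, mJ.act e x = x) :
    ∃ R : (A →L[ℂ] J) →L[ℂ] J, IsMorphism (coinduced A J) mJ R ∧
      ∀ x, R (mJ.act.flip x) = x := by
  obtain ⟨R, hR, hRT⟩ := h J (A →L[ℂ] J) mJ (coinduced A J) mJ.act.flip
    (ContinuousLinearMap.id ℂ J)
    (fun a x => by
      ext b
      simp [coinduced_act_apply, mJ.mul_act])
    ⟨fun x y hxy => by simpa [he] using congr($hxy e),
      ContinuousLinearMap.apply ℂ J e, by
        ext x
        simp [he]⟩
    (fun a x => rfl)
  exact ⟨R, hR, fun x => congr($hRT x)⟩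

end BanachLeftModule

/-- The diagonal entries of a family of vectors are controlled by its sums with random signs. -/
theorem sum_norm_diag_rpow_le {ι : Type*} [Fintype ι] {E : Type*} [NormedAddCommGroup E]
    [NormedSpace ℝ E] {p : ℝ} (hp : 0 ≤ p) (a : ι → ι → E) {K : ℝ}
    (h : ∀ ε : ι → ℤˣ, ∑ v, ‖∑ u, ((ε u : ℤ) : ℝ) • a u v‖ ^ p ≤ K) :
    ∑ v, ‖a v v‖ ^ p ≤ 2 * K := by
  classical
  let S (ε : ι → ℤˣ) (v : ι) : E := ∑ u, ((ε u : ℤ) : ℝ) • a u v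
  -- Multiplying by `c v` flips every sign except the one at `v`, so adding the two sums leaves
  -- twice the diagonal term.
  let c (v : ι) : ι → ℤˣ := fun u => if u = v then 1 else -1
  have hS : ∀ ε v, S ε v + S (c v * ε) v = (2 * ((ε v : ℤ) : ℝ)) • a v v := by
    intro ε v
    simp only [S, ← Finset.sum_add_distrib, ← add_smul]
    rw [Finset.sum_eq_single v]
    · simp [c, two_mul]
    · intro u _ hu
      simp [c, hu]
    · simp
  have hpt : ∀ ε v, ‖a v v‖ ^ p ≤ ‖S ε v‖ ^ p + ‖S (c v * ε) v‖ ^ p := by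
    intro ε v
    have hε : ‖(2 * ((ε v : ℤ) : ℝ))‖ = 2 := by
      rcases Int.units_eq_one_or (ε v) with h | h <;> simp [h]
    have h1 : 2 * ‖a v v‖ ≤ ‖S ε v‖ + ‖S (c v * ε) v‖ := by
      rw [← hε, ← norm_smul, ← hS]
      exact norm_add_le _ _
    have hn1 : 0 ≤ ‖S ε v‖ ^ p := by positivity
    have hn2 : 0 ≤ ‖S (c v * ε) v‖ ^ p := by positivity
    rcases le_total ‖S ε v‖ ‖S (c v * ε) v‖ with h2 | h2
    · have := Real.rpow_le_rpow (norm_nonneg (a v v)) (by linarith) hp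
        (y := ‖S (c v * ε) v‖)
      linarith
    · have := Real.rpow_le_rpow (norm_nonneg (a v v)) (by linarith) hp (y := ‖S ε v‖)
      linarith
  have hsum : ∀ v, ∑ _ε : ι → ℤˣ, ‖a v v‖ ^ p ≤ 2 * ∑ ε, ‖S ε v‖ ^ p := by
    intro v
    have he : ∑ ε, ‖S (c v * ε) v‖ ^ p = ∑ ε, ‖S ε v‖ ^ p :=
      Equiv.sum_comp (Equiv.mulLeft (c v)) fun ε => ‖S ε v‖ ^ p
    rw [two_mul]
    nth_rw 2 [← he]
    rw [← Finset.sum_add_distrib]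
    exact Finset.sum_le_sum fun ε _ => hpt ε v
  have hN : (0 : ℝ) < Fintype.card (ι → ℤˣ) := by exact_mod_cast Fintype.card_pos
  refine le_of_mul_le_mul_left ?_ hN
  calc (Fintype.card (ι → ℤˣ) : ℝ) * ∑ v, ‖a v v‖ ^ p
      = ∑ v, ∑ _ε : ι → ℤˣ, ‖a v v‖ ^ p := by simp [Finset.mul_sum]
    _ ≤ ∑ v, 2 * ∑ ε, ‖S ε v‖ ^ p := Finset.sum_le_sum fun v _ => hsum v
    _ = 2 * ∑ ε, ∑ v, ‖S ε v‖ ^ p := by rw [← Finset.mul_sum, Finset.sum_comm]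
    _ ≤ 2 * ∑ _ε : ι → ℤˣ, K := by gcongr with ε; exact h ε
    _ = Fintype.card (ι → ℤˣ) * (2 * K) := by simp; ring

theorem rpow_one_div_mul_rpow {a b r : ℝ} (hr : 0 < r) (ha : 0 ≤ a) (hb : 0 ≤ b) :
    (a ^ (1 / r) * b) ^ r = a * b ^ r := by
  rw [Real.mul_rpow (by positivity) hb, ← Real.rpow_mul ha, one_div_mul_cancel hr.ne',
    Real.rpow_one]

/-! ### Upper estimates for functionals on $\ell^\infty(G)$ -/

namespace Ell

variable {G : Type u}

/-- A truncation of `f` at a level comparable with `‖m f‖`, rescaled. -/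
theorem exists_truncation (m : Ell G ∞ →L[ℂ] ℂ) {p q : ℝ} (hp : 0 < p) (hpq : p ≤ q) :
    ∃ D : ℝ, 0 < D ∧ ∀ f : Ell G ∞, ∃ h : Ell G ∞,
      (∀ t, ‖h t‖ ^ p ≤ ‖f t‖ ^ q) ∧ D * ‖m f‖ ^ q ≤ ‖m h‖ ^ p := by
  classical
  set M : ℝ := ‖m‖ + 1 with hM
  have hM0 : 0 < M := by positivity
  refine ⟨M ^ p / (2 * M) ^ q, by positivity, fun f => ?_⟩
  -- Discarding the values of size at most `l` changes `m f` by at most `M * l`, half of `‖m f‖`.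
  set l : ℝ := ‖m f‖ / (2 * M) with hl
  have hl0 : 0 ≤ l := by positivity
  have hbig : Memℓp (fun t => if ‖f t‖ ≤ l then 0 else f t) ∞ := by
    refine memℓp_infty ⟨‖f‖, ?_⟩
    rintro _ ⟨t, rfl⟩
    dsimp only
    split_ifs
    · simp
    · exact lp.norm_apply_le_norm (by simp) f t
  let b : Ell G ∞ := ⟨_, hbig⟩
  have hb : ∀ t, b t = if ‖f t‖ ≤ l then 0 else f t := fun t => rfl
  have hfb : ‖f - b‖ ≤ l := by
    refine lp.norm_le_of_forall_le hl0 fun t => ?_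
    rw [lp.coeFn_sub, Pi.sub_apply, hb]
    split_ifs with ht
    · simpa using ht
    · simpa using hl0
  have hmb : M * l ≤ ‖m b‖ := by
    have h1 : ‖m (f - b)‖ ≤ M * l :=
      (m.le_opNorm _).trans (mul_le_mul (by linarith) hfb (norm_nonneg _) hM0.le)
    have h2 : ‖m f‖ ≤ ‖m (f - b)‖ + ‖m b‖ := by
      rw [map_sub]
      exact norm_le_norm_sub_add _ _
    have h3 : ‖m f‖ = 2 * (M * l) := by
      rw [hl]
      field_simp
    linarith
  have hr : ∀ x : ℝ, 0 ≤ x → (l ^ ((q - p) / p) * x) ^ p = l ^ (q - p) * x ^ p := fun x hx => by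
    rw [Real.mul_rpow (by positivity) hx, ← Real.rpow_mul hl0, div_mul_cancel₀ _ hp.ne']
  have hnorm : ‖((l ^ ((q - p) / p) : ℝ) : ℂ)‖ = l ^ ((q - p) / p) := by
    rw [Complex.norm_real, Real.norm_of_nonneg (by positivity)]
  have hadd : ∀ x : ℝ, 0 ≤ x → x ^ (q - p) * x ^ p = x ^ q := fun x hx => by
    rw [← Real.rpow_add_of_nonneg hx (by linarith) hp.le, sub_add_cancel]
  -- The factor has `p`-th power `l ^ (q - p)`, which is at most `‖f t‖ ^ (q - p)` wherever `b`
  -- retains `f t`.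
  refine ⟨((l ^ ((q - p) / p) : ℝ) : ℂ) • b, fun t => ?_, ?_⟩
  · rw [lp.coeFn_smul, Pi.smul_apply, norm_smul, hnorm, hr _ (norm_nonneg _), hb]
    split_ifs with ht
    · rw [norm_zero, Real.zero_rpow hp.ne', mul_zero]
      positivity
    · rw [← hadd _ (norm_nonneg (f t))]
      gcongr
      linarith
  · rw [map_smul, norm_smul, hnorm, hr _ (norm_nonneg _)]
    calc M ^ p / (2 * M) ^ q * ‖m f‖ ^ q = M ^ p * l ^ q := by
          rw [hl, Real.div_rpow (norm_nonneg _) (by positivity)]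
          ring
      _ = l ^ (q - p) * (M * l) ^ p := by
          rw [← hadd l hl0, Real.mul_rpow hM0.le hl0]
          ring
      _ ≤ l ^ (q - p) * ‖m b‖ ^ p := by gcongr

variable [Group G]

/-- A bounded functional on `ℓ^∞(G)` whose right translates satisfy an upper `p`-estimate with
constant `C`. -/
def HasUpperEstimate (m : Ell G ∞ →L[ℂ] ℂ) (p C : ℝ) : Prop :=
  ∀ (U : Finset G) (g : G → Ell G ∞) (K : ℝ), 0 ≤ K →
    (∀ t, ∑ u ∈ U, ‖g u (t * u)‖ ^ p ≤ K) → ∑ u ∈ U, ‖m (g u)‖ ^ p ≤ C * K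

theorem HasUpperEstimate.mono {m : Ell G ∞ →L[ℂ] ℂ} {p q C : ℝ} (hp : 0 < p) (hpq : p ≤ q)
    (h : HasUpperEstimate m p C) : ∃ C', HasUpperEstimate m q C' := by
  obtain ⟨D, hD, ht⟩ := exists_truncation m hp hpq
  choose τ hτ hτD using ht
  refine ⟨C / D, fun U g K hK hg => ?_⟩
  have := h U (fun u => τ (g u)) K hK fun t =>
    (Finset.sum_le_sum fun u _ => hτ (g u) (t * u)).trans (hg t)
  rw [div_mul_eq_mul_div, le_div_iff₀ hD, mul_comm, Finset.mul_sum]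
  exact (Finset.sum_le_sum fun u _ => hτD (g u)).trans this

-- With $R$ the retraction, $m(g)$ is the value at $1$ of $R(\delta_t\mapsto g(t)\delta_t)$. Module
-- translates of these operators combine with small norm, and random signs isolate the numbers
-- $m(g_u)$.
open BanachLeftModule in
theorem exists_hasUpperEstimate {p : ℝ≥0∞} [hp1 : Fact (1 ≤ p)] (hp : p ≠ ∞)
    (h : (banachModule G p).IsInjective) :
    ∃ (m : Ell G ∞ →L[ℂ] ℂ) (C : ℝ), m 1 = 1 ∧ HasUpperEstimate m p.toReal C := by
  classical
  have hp0 : 0 < p.toReal := ENNReal.toReal_pos (zero_lt_one.trans_le hp1.out).ne' hp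
  obtain ⟨R, hR, hRe⟩ := h.exists_retraction (e := delta 1 1) fun x => by
    refine lp.ext (funext fun s => ?_)
    change conv (delta 1 1) x s = x s
    rw [delta_conv, translate_apply, inv_one, one_mul]
  obtain ⟨M, hM⟩ := exists_mulCLM G
  let J : Ell G 1 →L[ℂ] Ell G p := (convCLM G p).flip (delta p 1)
  have hJ : ∀ t, J (delta 1 t) = delta p t := fun t => by
    change conv (delta 1 t) (delta p 1) = _
    rw [delta_conv, translate_delta, mul_one]
  let N : Ell G ∞ →L[ℂ] (Ell G 1 →L[ℂ] Ell G p) :=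
    (ContinuousLinearMap.compL ℂ (Ell G 1) (Ell G 1) (Ell G p) J) ∘L M
  have hN : ∀ g t, N g (delta 1 t) = g t • delta p t := fun g t => by
    change J (M g (delta 1 t)) = _
    rw [hM, map_smul, hJ]
  refine ⟨lp.evalCLM ℂ (fun _ : G => ℂ) p 1 ∘L R ∘L N, 2 * ‖R‖ ^ p.toReal, ?_, ?_⟩
  · have h1 : N 1 = (banachModule G p).act.flip (delta p 1) := clm_ext fun t => by
      rw [hN, lp.infty_coeFn_one, Pi.one_apply, one_smul]
      exact (hJ t).symm
    change R (N 1) 1 = 1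
    rw [h1, hRe, delta_apply_self]
  · intro U g K hK hg
    have key : ∀ ε : U → ℤˣ, ∑ v : U, ‖∑ u : U, ((ε u : ℤ) : ℝ) •
        translate (u : G) (R (N (g u))) v‖ ^ p.toReal ≤ ‖R‖ ^ p.toReal * K := by
      intro ε
      -- `Y` sends $\delta_t$ to $\sum_u\varepsilon_u\,g_u(tu)\,\delta_{tu}$. The points $tu$ are
      -- distinct, so the norm of this vector is independent of the signs.
      set Y : Ell G 1 →L[ℂ] Ell G p := ∑ u : U, ((ε u : ℤ) : ℂ) •
        (coinduced (Ell G 1) (Ell G p)).act (delta 1 (u : G)) (N (g u)) with hY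
      have hRY : R Y = ∑ u : U, ((ε u : ℤ) : ℂ) • translate (u : G) (R (N (g u))) := by
        rw [hY, map_sum]
        refine Finset.sum_congr rfl fun u _ => ?_
        rw [map_smul, hR, ← delta_conv]
        rfl
      have hYn : ‖Y‖ ≤ K ^ (1 / p.toReal) := by
        refine norm_clm_le (by positivity) fun t => ?_
        have hYt : Y (delta 1 t) = ∑ s ∈ U.image (t * ·), lp.single p s
            (if hs : t⁻¹ * s ∈ U then ((ε ⟨t⁻¹ * s, hs⟩ : ℤ) : ℂ) * g (t⁻¹ * s) s else 0) := by
          rw [hY, Finset.sum_image (by simp), ← Finset.sum_coe_sort U,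
            sum_apply]
          refine Finset.sum_congr rfl fun u _ => ?_
          rw [smul_apply, coinduced_act_apply, delta_mul_delta, hN, delta,
            ← lp.single_smul, ← lp.single_smul]
          simp
        rw [← Real.rpow_le_rpow_iff (norm_nonneg _) (by positivity) hp0, hYt,
          lp.norm_sum_single hp0, Finset.sum_image (by simp), ← Real.rpow_mul hK,
          one_div_mul_cancel hp0.ne', Real.rpow_one]
        refine (Finset.sum_le_sum fun u hu => ?_).trans (hg t)
        rcases Int.units_eq_one_or (ε ⟨u, hu⟩) with h | h <;> simp [hu, h]
      have hRYn : ‖R Y‖ ^ p.toReal ≤ ‖R‖ ^ p.toReal * K := by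
        calc ‖R Y‖ ^ p.toReal ≤ (‖R‖ * K ^ (1 / p.toReal)) ^ p.toReal := by
              gcongr
              exact (R.le_opNorm Y).trans (by gcongr)
          _ = ‖R‖ ^ p.toReal * K := by
              rw [mul_comm, rpow_one_div_mul_rpow hp0 hK (norm_nonneg R), mul_comm]
      refine le_trans ?_ ((lp.sum_rpow_le_norm_rpow hp0 (R Y) U).trans hRYn)
      rw [← Finset.sum_coe_sort U]
      refine (Finset.sum_congr rfl fun v _ => ?_).le
      rw [hRY, lp.coeFn_sum, Finset.sum_apply]
      congr 2
    -- The diagonal entry at `v` is the translate by `v` evaluated at `v`, that is, `m (g v)`.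
    have := sum_norm_diag_rpow_le hp0.le _ key
    rw [← Finset.sum_coe_sort U, mul_assoc]
    refine le_trans (Finset.sum_congr rfl fun v _ => ?_).le this
    rw [translate_apply, inv_mul_cancel]
    rfl

-- With $L$ a linear left inverse of $T$, the extension is $(Ry)(u)=m\bigl(t\mapsto
-- S(L(\delta_{tu^{-1}}\cdot y))(t)\bigr)$. The upper estimate is exactly what puts $Ry$ in
-- $\ell^p$.
open BanachLeftModule in
theorem isInjective_of_hasUpperEstimate {p : ℝ≥0∞} [hp1 : Fact (1 ≤ p)] (hp : p ≠ ∞)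
    {m : Ell G ∞ →L[ℂ] ℂ} {C : ℝ} (hm1 : m 1 = 1) (hm : HasUpperEstimate m p.toReal C) :
    (banachModule G p).IsInjective := by
  intro E F _ _ _ _ _ _ mE mF T S hT ⟨_, L, hL⟩ hS
  have hp0 : 0 < p.toReal := ENNReal.toReal_pos (zero_lt_one.trans_le hp1.out).ne' hp
  let B : F →L[ℂ] Ell G 1 →L[ℂ] Ell G p :=
    (ContinuousLinearMap.compL ℂ (Ell G 1) F (Ell G p) (S ∘L L)) ∘L mF.act.flip
  have hB : ∀ y a, B y a = S (L (mF.act a y)) := fun y a => rfl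
  have hBn : ∀ y t, ‖B y (delta 1 t)‖ ≤ ‖B‖ * ‖y‖ := fun y t => by
    simpa [norm_delta] using B.le_opNorm₂ y (delta 1 t)
  have hmem : ∀ y u, Memℓp (fun t => B y (delta 1 (t * u⁻¹)) t) ∞ := fun y u => by
    refine memℓp_infty ⟨‖B‖ * ‖y‖, ?_⟩
    rintro _ ⟨t, rfl⟩
    exact (lp.norm_apply_le_norm (zero_lt_one.trans_le hp1.out).ne' _ _).trans (hBn _ _)
  let ψ : F → G → Ell G ∞ := fun y u => ⟨_, hmem y u⟩
  have hψ : ∀ y u t, ψ y u t = B y (delta 1 (t * u⁻¹)) t := fun y u t => rfl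
  have hsum : ∀ y (U : Finset G), ∑ u ∈ U, ‖m (ψ y u)‖ ^ p.toReal ≤
      C * (‖B‖ * ‖y‖) ^ p.toReal := fun y U => by
    refine hm U (ψ y) _ (by positivity) fun t => ?_
    -- At $tu$ the function `ψ y u` reads off coordinate $tu$ of the single vector `B y (delta 1
    -- t)`, whatever `u` is.
    simp only [hψ, mul_inv_cancel_right]
    have hle := lp.sum_rpow_le_norm_rpow hp0 (B y (delta 1 t)) (U.map (mulLeftEmbedding t))
    rw [Finset.sum_map] at hle
    refine hle.trans ?_
    gcongr
    exact hBn y t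
  have hC : C ≤ |C| := le_abs_self C
  let R₀ : F →ₗ[ℂ] Ell G p :=
    { toFun := fun y => ⟨fun u => m (ψ y u), memℓp_gen' (hsum y)⟩
      map_add' := fun y z => by
        refine lp.ext (funext fun u => ?_)
        change m (ψ (y + z) u) = m (ψ y u) + m (ψ z u)
        rw [← map_add]
        congr 1
        refine lp.ext (funext fun t => ?_)
        simp [hψ]
      map_smul' := fun c y => by
        refine lp.ext (funext fun u => ?_)
        change m (ψ (c • y) u) = c • m (ψ y u)
        rw [← map_smul]
        congr 1
        refine lp.ext (funext fun t => ?_)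
        simp [hψ] }
  let R : F →L[ℂ] Ell G p := R₀.mkContinuous (|C| ^ (1 / p.toReal) * ‖B‖) fun y => by
    refine lp.norm_le_of_forall_sum_le hp0 (by positivity) fun U => (hsum y U).trans ?_
    rw [mul_assoc, rpow_one_div_mul_rpow hp0 (abs_nonneg C) (by positivity)]
    gcongr
  have hRa : ∀ y u, R y u = m (ψ y u) := fun y u => rfl
  refine ⟨R, fun a y => ?_, ?_⟩
  · have : R ∘L mF.act.flip y = (convCLM G p).flip (R y) := clm_ext fun s => by
      refine lp.ext (funext fun u => ?_)
      change R (mF.act (delta 1 s) y) u = conv (delta 1 s) (R y) u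
      rw [delta_conv, translate_apply, hRa, hRa]
      congr 1
      refine lp.ext (funext fun t => ?_)
      have hBs : B (mF.act (delta 1 s) y) (delta 1 (t * u⁻¹)) =
          B y (delta 1 (t * (s⁻¹ * u)⁻¹)) := by
        rw [hB, hB, ← mF.mul_act, delta_mul_delta, mul_inv_rev, inv_inv, mul_assoc]
      rw [hψ, hψ, hBs]
    exact congr($this a)
  · ext1 x
    refine lp.ext (funext fun u => ?_)
    change R (T x) u = S x u
    -- On the range of `T`, `L` undoes `T` and `S` is equivariant, so the averaged function is
    -- constant and `m 1 = 1` applies.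
    have hc : ψ (T x) u = S x u • (1 : Ell G ∞) := lp.ext (funext fun t => by
      have hLT : L (T (mE.act (delta 1 (t * u⁻¹)) x)) = mE.act (delta 1 (t * u⁻¹)) x :=
        congr($hL _)
      rw [hψ, hB, ← hT, hLT, hS]
      change conv _ (S x) t = _
      simp [delta_conv, translate_apply])
    rw [hRa, hc, map_smul, hm1, smul_eq_mul, mul_one]

end Ell

end

theorem mainTheorem6 (G : Type u) [Group G] (p q : ℝ≥0∞) [Fact (1 ≤ p)] [Fact (1 ≤ q)]
    (hp : 1 < p) (hpq : p ≤ q) (hq : q < ∞)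
    (h : (Ell.banachModule G p).IsInjective) :
    (Ell.banachModule G q).IsInjective := by
  obtain ⟨m, C, hm1, hm⟩ := Ell.exists_hasUpperEstimate (hpq.trans_lt hq).ne h
  obtain ⟨C', hm'⟩ := hm.mono
    (ENNReal.toReal_pos (zero_lt_one.trans hp).ne' (hpq.trans_lt hq).ne)
    (ENNReal.toReal_mono hq.ne hpq)
  exact Ell.isInjective_of_hasUpperEstimate hq.ne hm1 hm'
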